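/- Let $A\in\mathbb{Z}^{d\times n}$ and let $K$ be a field. The toric ideal of $A$ is $I_A=\langle x^u-x^v : Au=Av,\ u,v\in\mathbb{Z}^n_{+}\rangle\subseteq K[x_1,\dots,x_n]$. The universal Gröbner basis $\mathcal{U}(A)$ is the (finite) set of all vectors $u\in\mathbb{Z}^n$ such that, for some term order, $x^{u^+}-x^{u^-}$, with leading term $x^{u^+}$, is an element of the reduced Gröbner basis of $I_A$; write $\mathcal{U}(A)=\{g_1,\dots,g_k\}$ with $g_1,\dots,g_k$ distinct. For $N\ge 0$, let $$A^{(N)}=\begin{pmatrix} I_n & I_n & \cdots & I_n\\ A & & & \\ & A & & \\ & & \ddots & \\ & & & A\end{pmatrix}$$ with $N$ blocks $I_n$ and $N$ blocks $A$; a vector $x\in\mathbb{Z}^{Nn}$ is written $x=(x^1,\dots,x^N)$ with layers $x^j\in\mathbb{Z}^n$. Assume that $\mathcal{U}(A)$ is symmetric, that is, $g\in\mathcal{U}(A)$ implies $-g\in\mathcal{U}(A)$. Let $\lambda\in\mathbb{Z}^k_{+}$ be the coefficient vector of a minimal nonnegative integer relation among $g_1,\dots,g_k$; that is, $\lambda\neq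 0$, $\sum_{i=1}^k\lambda_i g_i=0$, and no $\mu\in\mathbb{Z}^k_{+}$ with $0\ne\mu\neq\lambda$ and $\mu\le\lambda$ componentwise satisfies $\sum_{i=1}^k\mu_i g_i=0$. Let $s=\sum_{i=1}^k\lambda_i$, and let $x=(x^1,\dots,x^s)\in\mathbb{Z}^{sn}$ be any vector which, for each $i$, has exactly $\lambda_i$ layers equal to $g_i$ (in any order). Then $x\in\ker(A^{(s)})$ and $x\in\mathcal{U}(A^{(s)})$. -/

import Mathlib

open scoped Matrix

noncomputable section

namespace GroebnerComplexity

/-- The positive part `u⁺` of an integer vector, as an exponent vector. -/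
def posExp {σ : Type} [Fintype σ] (u : σ → ℤ) : σ →₀ ℕ :=
  Finsupp.equivFunOnFinite.symm (fun i => (u i).toNat)

/-- The negative part `u⁻` of an integer vector (so that `u = u⁺ - u⁻`), as an exponent vector. -/
def negExp {σ : Type} [Fintype σ] (u : σ → ℤ) : σ →₀ ℕ :=
  Finsupp.equivFunOnFinite.symm (fun i => (-u i).toNat)

/-- The binomial `x^{u⁺} - x^{u⁻}`. -/
def binomial (K : Type*) [Field K] {σ : Type} [Fintype σ] (u : σ → ℤ) : MvPolynomial σ K :=
  MvPolynomial.monomial (posExp u) 1 - MvPolynomial.monomial (negExp u) 1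

/-- The toric ideal `I_A = ⟨x^u - x^v : A u = A v, u, v ≥ 0⟩` in the polynomial ring over `K`. -/
def toricIdeal (K : Type*) [Field K] {ρ σ : Type} [Fintype σ] (A : Matrix ρ σ ℤ) :
    Ideal (MvPolynomial σ K) :=
  Ideal.span {f | ∃ u v : σ →₀ ℕ,
    A *ᵥ (fun i => (u i : ℤ)) = A *ᵥ (fun i => (v i : ℤ)) ∧
    f = MvPolynomial.monomial u 1 - MvPolynomial.monomial v 1}

/-- `G` is the (minimal) reduced Gröbner basis of the ideal `I` with respect to the term order `m`:
a finite subset of `I` consisting of monic polynomials, such that the leading monomial of each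
nonzero element of `I` is divisible by the leading monomial of an element of `G`, and such that no
monomial of an element of `G` is divisible by the leading monomial of another element of `G`. -/
structure IsReducedGroebnerBasis {K : Type*} [Field K] {σ : Type} (m : MonomialOrder.{0, 0} σ)
    (I : Ideal (MvPolynomial σ K)) (G : Set (MvPolynomial σ K)) : Prop where
  finite : G.Finite
  subset : ∀ g ∈ G, g ∈ I
  exists_degree_le : ∀ f ∈ I, f ≠ 0 → ∃ g ∈ G, m.degree g ≤ m.degree f
  monic : ∀ g ∈ G, m.Monic g
  reduced : ∀ g ∈ G, ∀ h ∈ G, h ≠ g → ∀ a ∈ g.support, ¬ m.degree h ≤ a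

/-- The universal Gröbner basis `U(A)`: the integer vectors `u` such that, for some term order,
`x^{u⁺} - x^{u⁻}` with leading term `x^{u⁺}` is an element of the reduced Gröbner basis of `I_A`.
If `2 ≠ 0` in `K`, the condition on the leading term already follows from monicity; stating it
makes the sign of `u` well defined in characteristic two as well. Term orders on the countable
monoid of exponent vectors can all be realized on a type in the lowest universe. -/
def universalGroebnerBasis (K : Type*) [Field K] {ρ σ : Type} [Fintype σ] (A : Matrix ρ σ ℤ) :
    Set (σ → ℤ) :=
  {u | ∃ (m : MonomialOrder.{0, 0} σ) (G : Set (MvPolynomial σ K)),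
    IsReducedGroebnerBasis m (toricIdeal K A) G ∧ binomial K u ∈ G ∧
    m.toSyn (negExp u) < m.toSyn (posExp u)}

/-- The higher Lawrence lifting `A^{(N)}`: one block row of `N` identity matrices on top of the
block diagonal matrix with `N` copies of `A`. -/
def lawrenceLifting {ρ σ : Type} [DecidableEq σ] (A : Matrix ρ σ ℤ) (N : ℕ) :
    Matrix (σ ⊕ (Fin N × ρ)) (Fin N × σ) ℤ :=
  Matrix.of fun r c =>
    match r with
    | Sum.inl i => if i = c.2 then 1 else 0
    | Sum.inr (j, i) => if j = c.1 then A i c.2 else 0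

/-- The `j`-th layer of a vector `x = (x^1, …, x^N)`. -/
def layer {σ : Type} {N : ℕ} (x : Fin N × σ → ℤ) (j : Fin N) : σ → ℤ :=
  fun i => x (j, i)

/-- `lam` is the coefficient vector of a minimal nonnegative integer relation
`∑ g ∈ U, lam g • g = 0`: it is nonzero, and minimal in the componentwise order among the
nonzero nonnegative integer coefficient vectors of such relations. -/
def IsMinimalRelation {σ : Type} (U : Set (σ → ℤ)) (lam : U →₀ ℕ) : Prop :=
  Minimal (fun mu : U →₀ ℕ => mu ≠ 0 ∧ (mu.sum fun g c => c • (g : σ → ℤ)) = 0) lam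

end GroebnerComplexity

end

namespace GroebnerComplexity

/-! A vector `u` lies in the universal Gröbner basis exactly when, for some term order, `u⁺` is a
minimal nonstandard monomial and `u⁻` the standard monomial of its fiber
(`mem_universalGroebnerBasis_iff`). When `u` and `-u` both qualify, the two term orders together
force `u⁺` and `u⁻` to span an edge of their fiber (`eq_or_eq_of_sum_mem_line`). Conversely, an edge
between points with disjoint supports, in a fiber of a positively graded matrix, yields a term order
whose two smallest fiber points are the ends of the edge (`exists_monomialOrder_of_edge`).

By symmetry of `U(A)`, every layer of `x` gives an edge. Suppose the barycenter of some points of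
the fiber of `x⁺` lies on the ray from `x⁺` through `x⁻`. Projecting to layers, each layer of each
point is the positive or the negative part of that layer of `x`. The identity blocks make the layers
taking the negative part sum to zero, so by minimality of the relation they are none or all. Hence
`x⁺` and `x⁻` span an edge. -/

/-! ### Total orders on torsion-free groups -/

/-- Every positive cone of a torsion-free abelian group is contained in the cone of a total
order. -/
theorem exists_total_cone {G : Type*} [AddCommGroup G] [IsAddTorsionFree G] (S : AddGroupCone G) :
    ∃ T : AddGroupCone G, (∀ a ∈ S, a ∈ T) ∧ ∀ a, a ∈ T ∨ -a ∈ T := by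
  obtain ⟨T, hST, hT⟩ := zorn_le_nonempty₀
    {T : AddSubmonoid G | ∀ a, a ∈ T → -a ∈ T → a = 0} (by
      intro c hc hchain y hy
      refine ⟨sSup c, ?_, fun z hz => le_sSup hz⟩
      intro a ha ha'
      rw [AddSubmonoid.mem_sSup_of_directedOn ⟨y, hy⟩ hchain.directedOn] at ha ha'
      obtain ⟨T₁, hT₁, ha⟩ := ha
      obtain ⟨T₂, hT₂, ha'⟩ := ha'
      rcases hchain.total hT₁ hT₂ with h | h
      · exact hc hT₂ a (h ha) ha'
      · exact hc hT₁ a ha (h ha'))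
    S.toAddSubmonoid (fun a => S.eq_zero_of_mem_of_neg_mem')
  -- By maximality, adjoining `a` to `T` must destroy pointedness.
  have key : ∀ a, a ∉ T → ∃ k : ℕ, k ≠ 0 ∧ -(k • a) ∈ T := by
    intro a ha
    by_contra! hk
    refine ha (hT.2 (y := T ⊔ AddSubmonoid.multiples a) ?_ le_sup_left ?_)
    · intro b hb hb'
      obtain ⟨s, hs, _, ⟨k, rfl⟩, rfl⟩ := AddSubmonoid.mem_sup.1 hb
      obtain ⟨t, ht, _, ⟨l, rfl⟩, h⟩ := AddSubmonoid.mem_sup.1 hb'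
      have hst : s + t = -((k + l) • a) := by
        simp only at h
        rw [add_nsmul]
        have := congrArg (· + (s + k • a)) h
        simp only [neg_add_cancel] at this
        rw [eq_neg_iff_add_eq_zero, ← this]
        abel
      by_cases hkl : k + l = 0
      · have hk0 : k = 0 := by omega
        subst hk0
        have : s = 0 := hT.1 s hs (by
          rw [hkl, zero_nsmul, neg_zero] at hst
          rwa [neg_eq_of_add_eq_zero_right hst])
        simp [this]
      · exact absurd (hst ▸ T.add_mem hs ht) (hk _ hkl)
    · exact (le_sup_right : AddSubmonoid.multiples a ≤ _) (AddSubmonoid.mem_multiples a)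
  refine ⟨{ T with eq_zero_of_mem_of_neg_mem' := fun {a} => hT.1 a }, hST, fun a => ?_⟩
  by_contra! h
  have h₁ : a ∉ T := h.1
  have h₂ : -a ∉ T := h.2
  obtain ⟨k, hk, hka⟩ := key a h₁
  obtain ⟨l, hl, hla⟩ := key (-a) h₂
  rw [smul_neg, neg_neg] at hla
  -- Both `(k * l) • a` and its negative are in `T`; torsion-freeness then gives `a = 0`.
  have h0 : (k * l) • a = 0 := by
    refine hT.1 _ ?_ ?_
    · rw [mul_nsmul']
      exact T.nsmul_mem hla k
    · rw [mul_nsmul, ← smul_neg]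
      exact T.nsmul_mem hka l
  have : a = 0 := (nsmul_eq_zero_iff_right (mul_ne_zero hk hl)).1 h0
  exact h₁ (this ▸ T.zero_mem)

/-! ### Term orders from cones -/

/-- The inclusion of the exponent vectors into the integer vectors. -/
def toIntVec (σ : Type) : (σ →₀ ℕ) →+ (σ → ℤ) where
  toFun u i := u i
  map_zero' := by ext; simp
  map_add' u v := by ext; simp

@[simp]
theorem toIntVec_apply {σ : Type} (u : σ →₀ ℕ) (i : σ) : toIntVec σ u i = u i := rfl

theorem toIntVec_injective (σ : Type) : Function.Injective (toIntVec σ) := by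
  intro u v h
  ext i
  exact Nat.cast_injective (R := ℤ) (congrFun h i)

/-- A synonym of the exponent vectors, to be ordered by a cone. -/
def ConeSyn (σ : Type) : Type := σ →₀ ℕ

noncomputable instance (σ : Type) : AddCommMonoid (ConeSyn σ) :=
  inferInstanceAs (AddCommMonoid (σ →₀ ℕ))

/-- A total cone of integer vectors that contains the nonnegative vectors defines a term order. -/
theorem exists_monomialOrder {σ : Type} [Finite σ] (T : AddGroupCone (σ → ℤ))
    (htotal : ∀ a, a ∈ T ∨ -a ∈ T) (hnonneg : ∀ w, toIntVec σ w ∈ T) :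
    ∃ m : MonomialOrder.{0, 0} σ,
      ∀ u v, m.toSyn u ≤ m.toSyn v ↔ toIntVec σ v - toIntVec σ u ∈ T := by
  classical
  let e : (σ →₀ ℕ) ≃+ ConeSyn σ := AddEquiv.refl _
  let _ : LinearOrder (ConeSyn σ) :=
    { le := fun u v => toIntVec σ (e.symm v) - toIntVec σ (e.symm u) ∈ T
      le_refl := fun u => by simp [zero_mem]
      le_trans := fun u v w h h' => by simpa using add_mem h' h
      le_antisymm := fun u v h h' => by
        have := AddGroupConeClass.eq_zero_of_mem_of_neg_mem h (by simpa using h')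
        exact e.symm.injective (toIntVec_injective σ (sub_eq_zero.1 this)).symm
      le_total := fun u v => by
        simpa using htotal (toIntVec σ (e.symm v) - toIntVec σ (e.symm u))
      toDecidableLE := Classical.decRel _ }
  have le_iff : ∀ u v, e u ≤ e v ↔ toIntVec σ v - toIntVec σ u ∈ T := fun u v => Iff.rfl
  have hmono : Monotone e := by
    intro u v huv
    rw [le_iff]
    have h := hnonneg (v - u)
    have : toIntVec σ v = toIntVec σ (v - u) + toIntVec σ u := by
      rw [← map_add, tsub_add_cancel_of_le huv]
    rwa [this, add_sub_cancel_right]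
  -- Dickson's lemma for the componentwise order passes to the coarser total order, which is
  -- therefore a well-order.
  have : WellQuasiOrderedLE (ConeSyn σ) :=
    hmono.wellQuasiOrderedLE_of_wellQuasiOrderedLE_of_surjective e.surjective
  have : IsOrderedAddMonoid (ConeSyn σ) :=
    { add_le_add_left := fun u v huv w => by
        change toIntVec σ (e.symm (v + w)) - toIntVec σ (e.symm (u + w)) ∈ T
        have huv' : toIntVec σ (e.symm v) - toIntVec σ (e.symm u) ∈ T := huv
        simpa using huv' }
  exact ⟨{ syn := ConeSyn σ, toSyn := e, toSyn_monotone := hmono }, le_iff⟩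

/-! ### Toric ideals -/

section Toric

variable {K : Type*} [Field K] {ρ σ : Type} [Fintype σ]

/-- The grading of the exponent vectors by a matrix. -/
noncomputable def fiberDegree (A : Matrix ρ σ ℤ) : (σ →₀ ℕ) →+ (ρ → ℤ) :=
  (Matrix.mulVecLin A).toAddMonoidHom.comp (toIntVec σ)

theorem monomial_sub_monomial_mem_toricIdeal {A : Matrix ρ σ ℤ} {u v : σ →₀ ℕ}
    (h : fiberDegree A u = fiberDegree A v) :
    MvPolynomial.monomial u 1 - MvPolynomial.monomial v 1 ∈ toricIdeal K A :=
  Ideal.subset_span ⟨u, v, h, rfl⟩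

/-- Elements of the toric ideal vanish under the specialization to the group algebra. -/
theorem mapDomain_fiberDegree_eq_zero {A : Matrix ρ σ ℤ} {f : MvPolynomial σ K}
    (hf : f ∈ toricIdeal K A) : Finsupp.mapDomain (fiberDegree A) (AddMonoidAlgebra.coeff f) = 0 := by
  have : toricIdeal K A ≤ RingHom.ker (AddMonoidAlgebra.mapDomainRingHom K (fiberDegree A)) := by
    refine Ideal.span_le.2 ?_
    rintro _ ⟨u, v, h, rfl⟩
    have h' : fiberDegree A u = fiberDegree A v := h
    simp only [SetLike.mem_coe, RingHom.mem_ker, map_sub, sub_eq_zero]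
    simp [AddMonoidAlgebra.mapDomainRingHom_apply, MvPolynomial.monomial, h']
  have h := congrArg AddMonoidAlgebra.coeff (RingHom.mem_ker.1 (this hf))
  simpa [AddMonoidAlgebra.mapDomainRingHom_apply] using h

/-- No fiber meets the support of an element of the toric ideal in a single point. -/
theorem exists_ne_mem_support {A : Matrix ρ σ ℤ} {f : MvPolynomial σ K}
    (hf : f ∈ toricIdeal K A) {u : σ →₀ ℕ} (hu : u ∈ f.support) :
    ∃ v ∈ f.support, v ≠ u ∧ fiberDegree A v = fiberDegree A u := by
  classical
  by_contra! h
  have h0 := DFunLike.congr_fun (mapDomain_fiberDegree_eq_zero hf) (fiberDegree A u)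
  rw [Finsupp.mapDomain, Finsupp.sum, Finsupp.finsetSum_apply, Finset.sum_eq_single u] at h0
  · rw [Finsupp.single_eq_same] at h0
    exact MvPolynomial.mem_support_iff.1 hu h0
  · intro v hv hvu
    exact Finsupp.single_eq_of_ne' (h v hv hvu)
  · intro hu'
    exact absurd hu hu'

end Toric

/-! ### Reduced Gröbner bases of toric ideals -/

section Binomial

variable {K : Type*} [Field K] {σ : Type}

theorem degree_monomial_sub_monomial {m : MonomialOrder.{0, 0} σ} {u v : σ →₀ ℕ}
    (h : m.toSyn v < m.toSyn u) :
    m.degree (MvPolynomial.monomial u (1 : K) - MvPolynomial.monomial v 1) = u := by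
  classical
  rw [MonomialOrder.degree_sub_of_lt]
  · simp [MonomialOrder.degree_monomial]
  · simpa [MonomialOrder.degree_monomial] using h

theorem coeff_monomial_sub_monomial_left {u v : σ →₀ ℕ} (h : v ≠ u) :
    (MvPolynomial.monomial u (1 : K) - MvPolynomial.monomial v 1).coeff u = 1 := by
  classical
  simp [MvPolynomial.coeff_monomial, h]

theorem coeff_monomial_sub_monomial_right {u v : σ →₀ ℕ} (h : v ≠ u) :
    (MvPolynomial.monomial u (1 : K) - MvPolynomial.monomial v 1).coeff v = -1 := by
  classical
  simp [MvPolynomial.coeff_monomial, h.symm]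

theorem monic_monomial_sub_monomial {m : MonomialOrder.{0, 0} σ} {u v : σ →₀ ℕ}
    (h : m.toSyn v < m.toSyn u) :
    m.Monic (MvPolynomial.monomial u (1 : K) - MvPolynomial.monomial v 1) := by
  have hne : v ≠ u := fun e => h.ne (congrArg _ e)
  rw [MonomialOrder.Monic, MonomialOrder.leadingCoeff, degree_monomial_sub_monomial h,
    coeff_monomial_sub_monomial_left hne]

theorem mem_support_monomial_sub_monomial {u v a : σ →₀ ℕ}
    (ha : a ∈ (MvPolynomial.monomial u (1 : K) - MvPolynomial.monomial v 1).support) :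
    a = u ∨ a = v := by
  classical
  have := MvPolynomial.support_sub σ _ _ ha
  rw [Finset.mem_union] at this
  exact this.imp (fun h => by simpa using MvPolynomial.support_monomial_subset h)
    (fun h => by simpa using MvPolynomial.support_monomial_subset h)

end Binomial

section Toric

variable {K : Type*} [Field K] {ρ σ : Type} [Fintype σ]

/-- The exponent vector `u` is not the smallest element of its fiber. -/
def IsNonoptimal (m : MonomialOrder.{0, 0} σ) (A : Matrix ρ σ ℤ) (u : σ →₀ ℕ) : Prop :=
  ∃ v, m.toSyn v < m.toSyn u ∧ fiberDegree A v = fiberDegree A u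

/-- Multiplying both monomials by `x^(w - u)` preserves the comparison and the equality of fibers;
so the nonstandard monomials form an ideal. -/
theorem IsNonoptimal.mono {m : MonomialOrder.{0, 0} σ} {A : Matrix ρ σ ℤ} {u w : σ →₀ ℕ}
    (hu : IsNonoptimal m A u) (h : u ≤ w) : IsNonoptimal m A w := by
  obtain ⟨v, hv, hvu⟩ := hu
  refine ⟨v + (w - u), ?_, ?_⟩
  · nth_rw 2 [← add_tsub_cancel_of_le h]
    rw [map_add, map_add]
    gcongr
  · nth_rw 2 [← add_tsub_cancel_of_le h]
    rw [map_add, map_add, hvu]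

theorem exists_optimal (m : MonomialOrder.{0, 0} σ) (A : Matrix ρ σ ℤ) (u : σ →₀ ℕ) :
    ∃ v, ¬ IsNonoptimal m A v ∧ m.toSyn v ≤ m.toSyn u ∧ fiberDegree A v = fiberDegree A u := by
  obtain ⟨v, hv, hmin⟩ := (InvImage.wf m.toSyn wellFounded_lt).has_min
    {v | fiberDegree A v = fiberDegree A u} ⟨u, rfl⟩
  refine ⟨v, ?_, not_lt.1 (hmin u rfl), hv⟩
  rintro ⟨w, hw, hwv⟩
  exact hmin w (hwv.trans hv) hw

variable (K) in
/-- The binomials `x^u - x^v` with `x^u` a minimal nonstandard monomial and `x^v` standard. -/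
def toricGroebnerBasis (m : MonomialOrder.{0, 0} σ) (A : Matrix ρ σ ℤ) :
    Set (MvPolynomial σ K) :=
  {f | ∃ u v, Minimal (IsNonoptimal m A) u ∧ ¬ IsNonoptimal m A v ∧
    m.toSyn v < m.toSyn u ∧ fiberDegree A v = fiberDegree A u ∧
    f = MvPolynomial.monomial u 1 - MvPolynomial.monomial v 1}

theorem eq_of_not_isNonoptimal {m : MonomialOrder.{0, 0} σ} {A : Matrix ρ σ ℤ} {v w : σ →₀ ℕ}
    (hv : ¬ IsNonoptimal m A v) (hw : ¬ IsNonoptimal m A w)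
    (h : fiberDegree A v = fiberDegree A w) : v = w := by
  by_contra hne
  rcases lt_or_gt_of_ne (m.toSyn.injective.ne hne) with hlt | hlt
  · exact hw ⟨v, hlt, h⟩
  · exact hv ⟨w, hlt, h.symm⟩

/-- This supplies the entire reduced basis needed to certify that a single binomial belongs to one.
It rests on each fiber having exactly one standard monomial. -/
theorem isReducedGroebnerBasis_toricGroebnerBasis (m : MonomialOrder.{0, 0} σ)
    (A : Matrix ρ σ ℤ) :
    IsReducedGroebnerBasis m (toricIdeal K A) (toricGroebnerBasis K m A) where
  finite := by
    have hfin : {u | Minimal (IsNonoptimal m A) u}.Finite :=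
      WellQuasiOrderedLE.finite_of_isAntichain (setOfPred_minimal_antichain _)
    choose o ho using exists_optimal m A
    refine (hfin.image fun u =>
      MvPolynomial.monomial u (1 : K) - MvPolynomial.monomial (o u) 1).subset ?_
    rintro _ ⟨u, v, hu, hv, -, hvu, rfl⟩
    refine ⟨u, hu, ?_⟩
    rw [eq_of_not_isNonoptimal hv (ho u).1 (hvu.trans (ho u).2.2.symm)]
  subset := by
    rintro _ ⟨u, v, -, -, -, hvu, rfl⟩
    exact monomial_sub_monomial_mem_toricIdeal hvu.symm
  exists_degree_le := by
    intro f hf hf0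
    obtain ⟨v, hv, hne, hfib⟩ := exists_ne_mem_support hf (m.degree_mem_support hf0)
    -- A second support point in the fiber of the leading exponent is necessarily smaller.
    have hnon : IsNonoptimal m A (m.degree f) :=
      ⟨v, lt_of_le_of_ne (m.le_degree hv) (m.toSyn.injective.ne hne), hfib⟩
    obtain ⟨u, hu, hmin⟩ := exists_minimal_le_of_wellFoundedLT (IsNonoptimal m A) _ hnon
    obtain ⟨w, hw, hwu⟩ := hmin.1
    obtain ⟨o, ho, hou, hof⟩ := exists_optimal m A w
    exact ⟨_, ⟨u, o, hmin, ho, hou.trans_lt hw, hof.trans hwu, rfl⟩,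
      (degree_monomial_sub_monomial (hou.trans_lt hw)).trans_le hu⟩
  monic := by
    rintro _ ⟨u, v, -, -, hlt, -, rfl⟩
    exact monic_monomial_sub_monomial hlt
  reduced := by
    rintro _ ⟨u, v, hu, hv, hlt, hvu, rfl⟩ _ ⟨u', v', hu', hv', hlt', hvu', rfl⟩ hne a ha hle
    rw [degree_monomial_sub_monomial hlt'] at hle
    rcases mem_support_monomial_sub_monomial ha with rfl | rfl
    · have : u' = a := le_antisymm hle (hu.2 hu'.1 hle)
      subst this
      exact hne (by rw [eq_of_not_isNonoptimal hv' hv (hvu'.trans hvu.symm)])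
    · exact hv (hu'.1.mono hle)

/-! ### Vectors of the universal Gröbner basis -/

@[simp]
theorem posExp_apply (u : σ → ℤ) (i : σ) : posExp u i = (u i).toNat := rfl

@[simp]
theorem negExp_apply (u : σ → ℤ) (i : σ) : negExp u i = (-u i).toNat := rfl

theorem posExp_neg (u : σ → ℤ) : posExp (-u) = negExp u := rfl

theorem negExp_neg (u : σ → ℤ) : negExp (-u) = posExp u := by
  ext i
  simp

theorem toIntVec_posExp_sub_negExp (u : σ → ℤ) :
    toIntVec σ (posExp u) - toIntVec σ (negExp u) = u := by
  ext i
  simp only [Pi.sub_apply, toIntVec_apply, posExp_apply, negExp_apply]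
  omega

theorem fiberDegree_negExp_eq_iff {A : Matrix ρ σ ℤ} {u : σ → ℤ} :
    fiberDegree A (negExp u) = fiberDegree A (posExp u) ↔ A *ᵥ u = 0 := by
  conv_rhs => rw [← toIntVec_posExp_sub_negExp u, Matrix.mulVec_sub, sub_eq_zero]
  exact eq_comm

/-- A vector belongs to the universal Gröbner basis if and only if, for some term order, its
positive part is a minimal nonstandard monomial and its negative part is the standard monomial of
the same fiber. -/
theorem mem_universalGroebnerBasis_iff {A : Matrix ρ σ ℤ} {u : σ → ℤ} :
    u ∈ universalGroebnerBasis K A ↔ A *ᵥ u = 0 ∧ ∃ m : MonomialOrder.{0, 0} σ,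
      m.toSyn (negExp u) < m.toSyn (posExp u) ∧
      Minimal (IsNonoptimal m A) (posExp u) ∧ ¬ IsNonoptimal m A (negExp u) := by
  constructor
  · rintro ⟨m, G, hG, huG, hlt⟩
    have hne : negExp u ≠ posExp u := fun e => hlt.ne (congrArg _ e)
    have hpos : posExp u ∈ (binomial K u).support := by
      rw [MvPolynomial.mem_support_iff, binomial, coeff_monomial_sub_monomial_left hne]
      exact one_ne_zero
    have hneg : negExp u ∈ (binomial K u).support := by
      rw [MvPolynomial.mem_support_iff, binomial, coeff_monomial_sub_monomial_right hne]
      exact neg_ne_zero.2 one_ne_zero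
    have hker : fiberDegree A (negExp u) = fiberDegree A (posExp u) := by
      obtain ⟨v, hv, hvne, hfib⟩ := exists_ne_mem_support (hG.subset _ huG) hpos
      rcases mem_support_monomial_sub_monomial hv with rfl | rfl
      · exact absurd rfl hvne
      · exact hfib
    -- The binomial `x^w - x^v` is in the ideal, so the leading monomial of some `h ∈ G` divides
    -- `x^w` and hence `x^a`; reducedness forces `h` to be the binomial of `u`.
    have key : ∀ a ∈ (binomial K u).support, ∀ w ≤ a, IsNonoptimal m A w → posExp u ≤ w := by
      rintro a ha w hwa ⟨v, hv, hvw⟩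
      obtain ⟨h, hhG, hle⟩ := hG.exists_degree_le _
        (monomial_sub_monomial_mem_toricIdeal (K := K) hvw.symm)
        (monic_monomial_sub_monomial hv).ne_zero
      rw [degree_monomial_sub_monomial hv] at hle
      by_cases hh : h = binomial K u
      · rwa [hh, binomial, degree_monomial_sub_monomial hlt] at hle
      · exact absurd (hle.trans hwa) (hG.reduced _ huG _ hhG hh a ha)
    refine ⟨fiberDegree_negExp_eq_iff.1 hker, m, hlt, ⟨⟨_, hlt, hker⟩, fun w hw hle =>
      key _ hpos w hle hw⟩, fun hn => ?_⟩
    exact hlt.not_ge (m.toSyn_monotone (key _ hneg _ le_rfl hn))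
  · rintro ⟨hker, m, hlt, hmin, hopt⟩
    exact ⟨m, _, isReducedGroebnerBasis_toricGroebnerBasis m A,
      ⟨_, _, hmin, hopt, hlt, fiberDegree_negExp_eq_iff.2 hker, rfl⟩, hlt⟩

end Toric

/-! ### Edges of fibers -/

section Edge

variable {ρ σ : Type} [Fintype σ]

/-- A point of the fiber of a minimal nonstandard monomial that shares a variable with it is
larger. -/
theorem lt_of_minimal_isNonoptimal {m : MonomialOrder.{0, 0} σ} {A : Matrix ρ σ ℤ}
    {p y : σ →₀ ℕ} (hp : Minimal (IsNonoptimal m A) p) (hy : fiberDegree A y = fiberDegree A p)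
    (hne : y ≠ p) {k : σ} (hyk : y k ≠ 0) (hpk : p k ≠ 0) : m.toSyn p < m.toSyn y := by
  classical
  by_contra hlt
  have hlt : m.toSyn y < m.toSyn p := lt_of_le_of_ne (not_lt.1 hlt) (m.toSyn.injective.ne hne)
  have hle : ∀ {z : σ →₀ ℕ}, z k ≠ 0 → z - Finsupp.single k 1 + Finsupp.single k 1 = z := by
    intro z hz
    refine tsub_add_cancel_of_le (Finsupp.single_le_iff.2 (Nat.one_le_iff_ne_zero.2 hz))
  -- If `y` were smaller, cancelling the common variable `k` would give a proper divisor of `x^p`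
  -- that is still nonstandard.
  have hnon : IsNonoptimal m A (p - Finsupp.single k 1) := by
    refine ⟨y - Finsupp.single k 1, ?_, ?_⟩
    · rw [← hle hyk, ← hle hpk, map_add, map_add] at hlt
      exact lt_of_add_lt_add_right hlt
    · rw [← hle hyk, ← hle hpk, map_add, map_add] at hy
      exact add_right_cancel hy
  have := hp.2 hnon tsub_le_self k
  simp only [Finsupp.coe_tsub, Pi.sub_apply, Finsupp.single_eq_same] at this
  omega

theorem le_of_not_isNonoptimal {m : MonomialOrder.{0, 0} σ} {A : Matrix ρ σ ℤ} {q y : σ →₀ ℕ}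
    (hq : ¬ IsNonoptimal m A q) (hy : fiberDegree A y = fiberDegree A q) :
    m.toSyn q ≤ m.toSyn y :=
  not_lt.1 fun h => hq ⟨y, h, hy⟩

theorem exists_sum_map_eq_nsmul_add_nsmul {ι M : Type*} [AddCommMonoid M] {p q : M} {r : ι → M}
    (Y : Multiset ι) (hr : ∀ y ∈ Y, r y = p ∨ r y = q) :
    ∃ b c : ℕ, b + c = Multiset.card Y ∧ (Y.map r).sum = b • p + c • q := by
  induction Y using Multiset.induction_on with
  | empty => exact ⟨0, 0, by simp⟩
  | cons y Y ih =>
    obtain ⟨b, c, hbc, h⟩ := ih fun z hz => hr z (Multiset.mem_cons_of_mem hz)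
    rw [Multiset.map_cons, Multiset.sum_cons, h, Multiset.card_cons]
    rcases hr y (Multiset.mem_cons_self y Y) with hy | hy
    · exact ⟨b + 1, c, by omega, by rw [hy, succ_nsmul']; abel⟩
    · exact ⟨b, c + 1, by omega, by rw [hy, succ_nsmul']; abel⟩

/-- If `p` and `q` are the standard monomials of a fiber for two term orders, and each is a minimal
nonstandard monomial for the other one, then `p` and `q` span an edge of the fiber: points of the
fiber whose barycenter is on the line through `p` and `q` are equal to `p` or `q`. -/
theorem eq_or_eq_of_sum_mem_line {A : Matrix ρ σ ℤ} {m m' : MonomialOrder.{0, 0} σ}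
    {p q : σ →₀ ℕ} (hfib : fiberDegree A q = fiberDegree A p)
    (hp : Minimal (IsNonoptimal m A) p) (hq : ¬ IsNonoptimal m A q)
    (hp' : ¬ IsNonoptimal m' A p) (hq' : Minimal (IsNonoptimal m' A) q)
    {Y : Multiset (σ →₀ ℕ)} (hY : ∀ y ∈ Y, fiberDegree A y = fiberDegree A p) {a : ℕ}
    (hsum : Y.sum + a • p = Multiset.card Y • p + a • q) :
    ∀ y ∈ Y, y = p ∨ y = q := by
  have hne : q ≠ p := fun e => hq (e ▸ hp.1)
  have hlt : m.toSyn q < m.toSyn p :=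
    lt_of_le_of_ne (le_of_not_isNonoptimal hq hfib.symm) (m.toSyn.injective.ne hne)
  have hlt' : m'.toSyn p < m'.toSyn q :=
    lt_of_le_of_ne (le_of_not_isNonoptimal hp' hfib) (m'.toSyn.injective.ne hne.symm)
  -- Zero is the minimum for every term order; in this fiber it would equal both `p` and `q`.
  have hzero : fiberDegree A (0 : σ →₀ ℕ) ≠ fiberDegree A p := by
    intro h
    have hopt : ∀ m : MonomialOrder.{0, 0} σ, ¬ IsNonoptimal m A 0 := by
      rintro m ⟨v, hv, -⟩
      rw [map_zero] at hv
      exact hv.not_ge (m.zero_le _)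
    exact hne ((eq_of_not_isNonoptimal hq (hopt m) (hfib.trans h.symm)).trans
      (eq_of_not_isNonoptimal (hopt m') hp' h))
  have hsupp : ∀ y ∈ Y, ∀ k, p k = 0 → q k = 0 → y k = 0 := by
    intro y hy k hpk hqk
    have h1 := DFunLike.congr_fun hsum k
    have h2 : y k ≤ Y.sum k := Multiset.le_sum_of_mem hy k
    simp only [Finsupp.add_apply, Finsupp.smul_apply, hpk, hqk, smul_zero, add_zero] at h1
    omega
  -- Each `y` is rounded to an end of the edge with which it shares a variable. That end is below
  -- `y` in both orders: in one because it is standard, in the other because it is minimal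
  -- nonstandard.
  have hround : ∀ y ∈ Y, ∃ z, (z = p ∨ z = q) ∧ m.toSyn z ≤ m.toSyn y ∧
      m'.toSyn z ≤ m'.toSyn y ∧
      (y ≠ p → y ≠ q → m.toSyn z < m.toSyn y ∧ m'.toSyn z < m'.toSyn y) := by
    intro y hy
    by_cases hyp : y = p
    · exact ⟨p, Or.inl rfl, by rw [hyp], by rw [hyp], fun h => absurd hyp h⟩
    by_cases hyq : y = q
    · exact ⟨q, Or.inr rfl, by rw [hyq], by rw [hyq], fun _ h => absurd hyq h⟩
    have hy0 : y ≠ 0 := fun h => hzero (h ▸ hY y hy)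
    obtain ⟨k, hk⟩ := Finsupp.ne_iff.1 hy0
    have hyfq : fiberDegree A y = fiberDegree A q := (hY y hy).trans hfib.symm
    by_cases hpk : p k = 0
    · have hqk : q k ≠ 0 := fun h => hk (hsupp y hy k hpk h)
      have h1 := lt_of_le_of_ne (le_of_not_isNonoptimal hq hyfq)
        (m.toSyn.injective.ne (Ne.symm hyq))
      have h2 := lt_of_minimal_isNonoptimal hq' hyfq hyq hk hqk
      exact ⟨q, Or.inr rfl, h1.le, h2.le, fun _ _ => ⟨h1, h2⟩⟩
    · have h1 := lt_of_minimal_isNonoptimal hp (hY y hy) hyp hk hpk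
      have h2 := lt_of_le_of_ne (le_of_not_isNonoptimal hp' (hY y hy))
        (m'.toSyn.injective.ne (Ne.symm hyp))
      exact ⟨p, Or.inl rfl, h1.le, h2.le, fun _ _ => ⟨h1, h2⟩⟩
  choose! r hr using hround
  intro y hy
  by_contra! hyne
  obtain ⟨b, c, hbc, hsumr⟩ := exists_sum_map_eq_nsmul_add_nsmul Y fun y hy => (hr y hy).1
  -- Comparing the sum of `Y` with the sum of its rounding leaves an inequality between multiples of
  -- `p` and `q` only. It holds in both orders, although they compare `p` and `q` oppositely: `m`
  -- refutes it if `c ≤ a`, and `m'` if `a ≤ c`.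
  have main : ∀ m : MonomialOrder.{0, 0} σ, (∀ y ∈ Y, m.toSyn (r y) ≤ m.toSyn y) →
      m.toSyn (r y) < m.toSyn y →
      c • m.toSyn q + a • m.toSyn p < c • m.toSyn p + a • m.toSyn q := by
    intro m hle hlt
    have h := Multiset.sum_lt_sum (s := Y) hle ⟨y, hy, hlt⟩
    have e1 : (Y.map fun y => m.toSyn (r y)).sum = b • m.toSyn p + c • m.toSyn q := by
      rw [← map_nsmul, ← map_nsmul, ← map_add, ← hsumr, map_multiset_sum, Multiset.map_map]
      rfl
    have e2 : (Y.map fun y => m.toSyn y).sum + a • m.toSyn p =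
        (b + c) • m.toSyn p + a • m.toSyn q := by
      have := congrArg m.toSyn hsum
      rwa [← hbc, map_add, map_add, map_nsmul, map_nsmul, map_nsmul, map_multiset_sum] at this
    have h3 := add_lt_add_left h (a • m.toSyn p)
    rw [e1, e2, add_nsmul, add_assoc, add_assoc] at h3
    exact lt_of_add_lt_add_left h3
  have h1 := main m (fun y hy => (hr y hy).2.1) ((hr y hy).2.2.2 hyne.1 hyne.2).1
  have h2 := main m' (fun y hy => (hr y hy).2.2.1) ((hr y hy).2.2.2 hyne.1 hyne.2).2
  rcases le_total c a with hca | hac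
  · obtain ⟨e, rfl⟩ := Nat.exists_eq_add_of_le hca
    rw [add_nsmul, add_nsmul, ← add_assoc, ← add_assoc, add_comm (c • m.toSyn p)] at h1
    exact (lt_of_add_lt_add_left h1).not_ge (nsmul_le_nsmul_right hlt.le e)
  · obtain ⟨e, rfl⟩ := Nat.exists_eq_add_of_le hac
    rw [add_nsmul, add_nsmul, add_right_comm, add_right_comm (a • m'.toSyn p),
      add_comm (a • m'.toSyn p)] at h2
    exact (lt_of_add_lt_add_left h2).not_ge (nsmul_le_nsmul_right hlt'.le e)

end Edge

/-! ### Term orders from edges -/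

section TermOrder

variable {ρ τ : Type} [Fintype τ]

/-- If `p` and `q` span an edge of a fiber of a positively graded matrix, then there is a term
order for which `q` is standard and `p` is the second smallest element of the fiber. -/
theorem exists_monomialOrder_of_edge {L : Matrix ρ τ ℤ} {p q : τ →₀ ℕ}
    (hdeg : ∀ u v : τ →₀ ℕ, fiberDegree L u = fiberDegree L v → u.degree = v.degree)
    (hfib : fiberDegree L q = fiberDegree L p) (hne : q ≠ p) (hdisj : Disjoint p q)
    (hedge : ∀ (Y : Multiset (τ →₀ ℕ)) (a : ℕ), (∀ y ∈ Y, fiberDegree L y = fiberDegree L p) →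
      Y.sum + a • p = Multiset.card Y • p + a • q → ∀ y ∈ Y, y = p ∨ y = q) :
    ∃ m : MonomialOrder.{0, 0} τ, m.toSyn q < m.toSyn p ∧
      Minimal (IsNonoptimal m L) p ∧ ¬ IsNonoptimal m L q := by
  let c := toIntVec τ
  let F : Set (τ →₀ ℕ) := {y | fiberDegree L y = fiberDegree L p ∧ y ≠ q}
  -- The cone generated by the nonnegative vectors, `p - q`, and all `y - p` with `y ≠ q` in the
  -- fiber. Its elements are `w + a(p - q) + ∑ (y - p)`; pointedness is where the edge hypothesis
  -- enters.
  let S : AddGroupCone (τ → ℤ) :=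
    { carrier := {v | ∃ (w : τ →₀ ℕ) (a : ℕ) (Y : Multiset (τ →₀ ℕ)), (∀ y ∈ Y, y ∈ F) ∧
        v + Multiset.card Y • c p = c w + a • (c p - c q) + c Y.sum}
      zero_mem' := ⟨0, 0, 0, by simp⟩
      add_mem' := by
        rintro v v' ⟨w, a, Y, hY, h⟩ ⟨w', a', Y', hY', h'⟩
        refine ⟨w + w', a + a', Y + Y', fun y hy => ?_, ?_⟩
        · exact (Multiset.mem_add.1 hy).elim (hY y) (hY' y)
        · have : _ + _ = _ + _ := congrArg₂ (· + ·) h h'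
          rw [Multiset.card_add, Multiset.sum_add, map_add, map_add, add_nsmul, add_nsmul,
            add_add_add_comm, h, h']
          abel
      eq_zero_of_mem_of_neg_mem' := by
        rintro v ⟨w, a, Y, hY, h⟩ ⟨w', a', Y', hY', h'⟩
        have hsum : (w + w') + ((Y + Y').sum + (a + a') • p) =
            Multiset.card (Y + Y') • p + (a + a') • q := by
          apply toIntVec_injective τ
          have : _ + _ = _ + _ := congrArg₂ (· + ·) h h'
          change c _ = c _
          simp only [map_add, map_nsmul, Multiset.sum_add, Multiset.card_add, add_nsmul]
          rw [← sub_eq_zero] at this ⊢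
          rw [← neg_eq_zero, ← this]
          simp only [nsmul_sub]
          abel
        have hYY : ∀ y ∈ Y + Y', y ∈ F := fun y hy =>
          (Multiset.mem_add.1 hy).elim (hY y) (hY' y)
        have hYdeg : ((Y + Y').map Finsupp.degree).sum =
            Multiset.card (Y + Y') • Finsupp.degree p := by
          rw [← Multiset.sum_replicate, ← Multiset.map_const']
          exact congrArg _ (Multiset.map_congr rfl fun y hy => hdeg _ _ (hYY y hy).1)
        -- All points of the fiber have the same degree, so nothing is left for `w + w'`.
        have hww : w + w' = 0 := by
          have := congrArg Finsupp.degree hsum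
          rw [map_add, map_add Finsupp.degree ((Y + Y').sum), map_multiset_sum, hYdeg,
            map_add _ (_ • p), map_nsmul, map_nsmul, map_nsmul, hdeg _ _ hfib] at this
          exact (Finsupp.degree_eq_zero_iff _).1 (by omega)
        rw [hww, zero_add] at hsum
        have hall : ∀ y ∈ Y + Y', y = p := fun y hy =>
          (hedge _ _ (fun y hy => (hYY y hy).1) hsum y hy).resolve_right (hYY y hy).2
        have hYp : ∀ Z : Multiset (τ →₀ ℕ), (∀ y ∈ Z, y = p) →
            Z.sum = Multiset.card Z • p := fun Z hZ => by
          rw [Multiset.eq_replicate_card.2 hZ, Multiset.sum_replicate, Multiset.card_replicate]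
        rw [hYp _ hall] at hsum
        have haa : a = 0 := by
          by_contra ha
          refine hne (Finsupp.ext fun i => ?_)
          have h1 := DFunLike.congr_fun (add_left_cancel hsum) i
          simp only [Finsupp.smul_apply, smul_eq_mul] at h1
          exact (Nat.eq_of_mul_eq_mul_left (by omega) h1).symm
        have hw : w = 0 := (add_eq_zero.1 hww).1
        rw [hYp Y fun y hy => hall y (Multiset.mem_add.2 (Or.inl hy)), haa, hw, map_zero,
          zero_nsmul, zero_add, zero_add, map_nsmul, add_eq_right] at h
        exact h }
  obtain ⟨T, hST, htotal⟩ := exists_total_cone S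
  obtain ⟨m, hm⟩ := exists_monomialOrder T htotal fun w => hST _ ⟨w, 0, 0, by simp [c]⟩
  have hqp : m.toSyn q ≤ m.toSyn p :=
    (hm _ _).2 (hST _ ⟨0, 1, 0, by simp, by simp [c]⟩)
  have hpF : ∀ y, fiberDegree L y = fiberDegree L p → y ≠ q → m.toSyn p ≤ m.toSyn y :=
    fun y hy hyq => (hm _ _).2 (hST _ ⟨0, 0, {y}, by simpa [F] using ⟨hy, hyq⟩, by simp [c]⟩)
  have hlt : m.toSyn q < m.toSyn p := lt_of_le_of_ne hqp (m.toSyn.injective.ne hne)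
  refine ⟨m, hlt, ⟨⟨q, hlt, hfib⟩, ?_⟩, ?_⟩
  · rintro w ⟨v, hv, hvw⟩ hwp
    have hw : w + (p - w) = p := add_tsub_cancel_of_le hwp
    -- This point lies in the fiber below `p`, and only `q` does. Then `p - w` divides both `p` and
    -- `q`, which have disjoint supports.
    have hvq : v + (p - w) = q := by
      by_contra hvq
      refine (hpF _ ?_ hvq).not_gt ?_
      · conv_rhs => rw [← hw]
        rw [map_add, map_add, hvw]
      · conv_rhs => rw [← hw]
        rw [map_add, map_add]
        gcongr
    have : p - w = 0 := le_bot_iff.1 (hdisj tsub_le_self (hvq ▸ le_add_self))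
    exact tsub_eq_zero_iff_le.1 this
  · rintro ⟨v, hv, hvq⟩
    exact hv.not_ge (hqp.trans (hpF v (hvq.trans hfib) fun h => hv.ne (congrArg _ h)))

end TermOrder

/-! ### Higher Lawrence liftings -/

section Layer

variable {σ : Type} [Fintype σ]

/-- The `j`-th layer of an exponent vector. -/
noncomputable def layerExp {N : ℕ} (j : Fin N) : (Fin N × σ →₀ ℕ) →+ (σ →₀ ℕ) where
  toFun u := Finsupp.equivFunOnFinite.symm fun i => u (j, i)
  map_zero' := by ext; simp
  map_add' u v := by ext; simp

@[simp]
theorem layerExp_apply {N : ℕ} (j : Fin N) (u : Fin N × σ →₀ ℕ) (i : σ) :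
    layerExp j u i = u (j, i) := rfl

theorem layerExp_posExp {N : ℕ} (j : Fin N) (x : Fin N × σ → ℤ) :
    layerExp j (posExp x) = posExp (layer x j) := rfl

theorem layerExp_negExp {N : ℕ} (j : Fin N) (x : Fin N × σ → ℤ) :
    layerExp j (negExp x) = negExp (layer x j) := rfl

theorem layerExp_ext {N : ℕ} {u v : Fin N × σ →₀ ℕ} (h : ∀ j, layerExp j u = layerExp j v) :
    u = v := by
  ext ⟨j, i⟩
  exact DFunLike.congr_fun (h j) i

end Layer

section Lawrence

variable {ρ σ : Type} [Fintype σ] [DecidableEq σ]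

theorem lawrenceLifting_mulVec_inl (A : Matrix ρ σ ℤ) {N : ℕ} (x : Fin N × σ → ℤ) (i : σ) :
    (lawrenceLifting A N *ᵥ x) (Sum.inl i) = ∑ j, layer x j i := by
  simp [lawrenceLifting, Matrix.mulVec, dotProduct, Fintype.sum_prod_type, layer]

theorem lawrenceLifting_mulVec_inr (A : Matrix ρ σ ℤ) {N : ℕ} (x : Fin N × σ → ℤ) (j : Fin N)
    (i : ρ) : (lawrenceLifting A N *ᵥ x) (Sum.inr (j, i)) = (A *ᵥ layer x j) i := by
  simp only [lawrenceLifting, Matrix.mulVec, dotProduct, Fintype.sum_prod_type, layer,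
    Matrix.of_apply, ite_mul, zero_mul]
  rw [Finset.sum_eq_single j] <;> simp +contextual [eq_comm]

theorem lawrenceLifting_mulVec_eq_iff {A : Matrix ρ σ ℤ} {N : ℕ} {x y : Fin N × σ → ℤ} :
    lawrenceLifting A N *ᵥ x = lawrenceLifting A N *ᵥ y ↔
      ∑ j, layer x j = ∑ j, layer y j ∧ ∀ j, A *ᵥ layer x j = A *ᵥ layer y j := by
  simp only [funext_iff, Sum.forall, Prod.forall, lawrenceLifting_mulVec_inl,
    lawrenceLifting_mulVec_inr, Finset.sum_apply]

theorem fiberDegree_lawrenceLifting_eq_iff {A : Matrix ρ σ ℤ} {N : ℕ}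
    {u v : Fin N × σ →₀ ℕ} :
    fiberDegree (lawrenceLifting A N) u = fiberDegree (lawrenceLifting A N) v ↔
      ∑ j, toIntVec σ (layerExp j u) = ∑ j, toIntVec σ (layerExp j v) ∧
        ∀ j, fiberDegree A (layerExp j u) = fiberDegree A (layerExp j v) :=
  lawrenceLifting_mulVec_eq_iff

/-- The identity blocks fix the sum of the layers, hence the total degree: the lifting is positively
graded for any `A`. -/
theorem degree_eq_of_fiberDegree_lawrenceLifting_eq {A : Matrix ρ σ ℤ} {N : ℕ}
    {u v : Fin N × σ →₀ ℕ}
    (h : fiberDegree (lawrenceLifting A N) u = fiberDegree (lawrenceLifting A N) v) :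
    u.degree = v.degree := by
  have h1 := congrArg (fun f : σ → ℤ => ∑ i, f i) (fiberDegree_lawrenceLifting_eq_iff.1 h).1
  simp only [Finset.sum_apply, toIntVec_apply, layerExp_apply] at h1
  rw [Finset.sum_comm, Finset.sum_comm (f := fun i j => ((v (j, i) : ℕ) : ℤ))] at h1
  rw [Finsupp.degree_eq_sum, Finsupp.degree_eq_sum, Fintype.sum_prod_type, Fintype.sum_prod_type]
  exact_mod_cast h1

theorem disjoint_posExp_negExp {τ : Type} [Fintype τ] (x : τ → ℤ) :
    Disjoint (posExp x) (negExp x) := by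
  rw [disjoint_iff]
  ext i
  simp only [Finsupp.inf_apply, posExp_apply, negExp_apply, bot_eq_zero,
    Finsupp.zero_apply]
  omega

/-- If the layers of `x` and their negatives belong to the universal Gröbner basis of `A`, and no
proper nonempty subset of the layers sums to zero, then `x` belongs to the universal Gröbner basis
of the higher Lawrence lifting. -/
theorem mem_universalGroebnerBasis_lawrenceLifting {K : Type*} [Field K] {A : Matrix ρ σ ℤ}
    {N : ℕ} {x : Fin N × σ → ℤ} (hx0 : x ≠ 0) (hker : lawrenceLifting A N *ᵥ x = 0)
    (hU : ∀ j, layer x j ∈ universalGroebnerBasis K A)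
    (hU' : ∀ j, -layer x j ∈ universalGroebnerBasis K A)
    (hmin : ∀ T : Finset (Fin N), ∑ j ∈ T, layer x j = 0 → T = ∅ ∨ T = Finset.univ) :
    x ∈ universalGroebnerBasis K (lawrenceLifting A N) := by
  classical
  have hfib := fiberDegree_negExp_eq_iff.2 hker
  have hne : negExp x ≠ posExp x := fun h => hx0 (by
    rw [← toIntVec_posExp_sub_negExp x, h, sub_self])
  refine mem_universalGroebnerBasis_iff.2 ⟨hker, exists_monomialOrder_of_edge
    (fun u v => degree_eq_of_fiberDegree_lawrenceLifting_eq) hfib hne (disjoint_posExp_negExp x) ?_⟩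
  intro Y a hY hsum y hy
  have hlayer : ∀ j, layerExp j y = posExp (layer x j) ∨ layerExp j y = negExp (layer x j) := by
    intro j
    obtain ⟨hA, m, -, hp, hq⟩ := mem_universalGroebnerBasis_iff.1 (hU j)
    obtain ⟨-, m', -, hq', hp'⟩ := mem_universalGroebnerBasis_iff.1 (hU' j)
    rw [posExp_neg] at hq'
    rw [negExp_neg] at hp'
    refine eq_or_eq_of_sum_mem_line (fiberDegree_negExp_eq_iff.2 hA) hp hq hp' hq'
      (Y := Y.map (layerExp j)) (a := a) ?_ ?_ _ (Multiset.mem_map_of_mem _ hy)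
    · intro z hz
      obtain ⟨y, hy, rfl⟩ := Multiset.mem_map.1 hz
      exact (fiberDegree_lawrenceLifting_eq_iff.1 (hY y hy)).2 j
    -- Projection to a layer keeps the relation, with the same `a` and the same number of points.
    · have := congrArg (layerExp j) hsum
      rwa [map_add, map_add, map_nsmul, map_nsmul, map_nsmul, map_multiset_sum,
        ← Multiset.card_map (layerExp j), layerExp_posExp, layerExp_negExp] at this
  let T : Finset (Fin N) := {j | layerExp j y ≠ posExp (layer x j)}
  have hneg : ∀ j ∈ T, layerExp j y = negExp (layer x j) := fun j hj =>
    (hlayer j).resolve_left (Finset.mem_filter.1 hj).2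
  have hpos : ∀ j, j ∉ T → layerExp j y = posExp (layer x j) := fun j hj => by
    by_contra h
    exact hj (Finset.mem_filter.2 ⟨Finset.mem_univ j, h⟩)
  -- `y` and `x⁺` have equal layer sums; their difference vanishes outside `T` and is `layer x j`
  -- for `j ∈ T`.
  have hT : ∑ j ∈ T, layer x j = 0 := by
    have h1 := (fiberDegree_lawrenceLifting_eq_iff.1 (hY y hy)).1
    rw [eq_comm, ← sub_eq_zero, ← Finset.sum_sub_distrib] at h1
    rw [← h1]
    refine Finset.sum_subset_zero_on_sdiff (Finset.subset_univ T) ?_ ?_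
    · intro j hj
      rw [hpos j (Finset.mem_sdiff.1 hj).2, layerExp_posExp, sub_self]
    · intro j hj
      rw [hneg j hj, layerExp_posExp, toIntVec_posExp_sub_negExp]
  rcases hmin T hT with h | h
  · left
    exact layerExp_ext fun j => by
      rw [hpos j (h ▸ Finset.notMem_empty j), layerExp_posExp]
  · right
    exact layerExp_ext fun j => by
      rw [hneg j (h ▸ Finset.mem_univ j), layerExp_negExp]

end Lawrence

/-! ### Minimal relations -/

theorem sum_sum_single {σ ι : Type*} {U : Set (σ → ℤ)} (g : ι → U) (T : Finset ι) :
    ((∑ j ∈ T, Finsupp.single (g j) 1).sum fun h c => c • (h : σ → ℤ)) =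
      ∑ j ∈ T, (g j : σ → ℤ) := by
  classical
  rw [← Finsupp.sum_finsetSum_index (h := fun (h : U) (c : ℕ) => c • (h : σ → ℤ))
    (fun _ => zero_nsmul _) fun _ _ _ => add_nsmul _ _ _]
  simp

/-- If a list of elements of `U` realizes a minimal relation, then no proper nonempty sublist sums
to zero. -/
theorem IsMinimalRelation.eq_empty_or_eq_univ {σ : Type} {U : Set (σ → ℤ)} {lam : U →₀ ℕ}
    (hlam : IsMinimalRelation U lam) {ι : Type*} [Fintype ι] {g : ι → U}
    (hg : ∑ j, Finsupp.single (g j) 1 = lam) {T : Finset ι}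
    (hT : ∑ j ∈ T, (g j : σ → ℤ) = 0) : T = ∅ ∨ T = Finset.univ := by
  classical
  rw [or_iff_not_imp_left]
  intro hne
  -- The multiplicities on `T` form a relation below `lam`; minimality leaves nothing for the
  -- complement.
  have hcompl : ∑ j ∈ T, Finsupp.single (g j) 1 + ∑ j ∈ Tᶜ, Finsupp.single (g j) 1 = lam := by
    rw [Finset.sum_add_sum_compl, hg]
  have hcard : ∀ T : Finset ι, (∑ j ∈ T, Finsupp.single (g j) 1).degree = T.card := fun T => by
    simp [Finsupp.degree_single]
  have hle := hlam.2 (y := ∑ j ∈ T, Finsupp.single (g j) 1) ⟨?_, ?_⟩ (hcompl ▸ le_self_add)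
  · have h0 : ∑ j ∈ Tᶜ, Finsupp.single (g j) 1 = 0 := by
      rw [← hcompl] at hle
      exact le_bot_iff.1 (le_of_add_le_add_left (hle.trans (add_zero _).ge))
    have := hcard Tᶜ
    rw [h0, map_zero] at this
    exact Finset.compl_eq_empty_iff T |>.1 (Finset.card_eq_zero.1 this.symm)
  · intro h0
    have := hcard T
    rw [h0, map_zero] at this
    exact hne (Finset.card_eq_zero.1 this.symm)
  · rwa [sum_sum_single]

end GroebnerComplexity

theorem lemma2 (K : Type*) [Field K] (d n : ℕ) (A : Matrix (Fin d) (Fin n) ℤ)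
    (hsymm : ∀ g ∈ GroebnerComplexity.universalGroebnerBasis K A,
      -g ∈ GroebnerComplexity.universalGroebnerBasis K A)
    (lam : GroebnerComplexity.universalGroebnerBasis K A →₀ ℕ)
    (hlam : GroebnerComplexity.IsMinimalRelation
      (GroebnerComplexity.universalGroebnerBasis K A) lam)
    (s : ℕ) (hs : s = lam.sum fun _ c => c)
    (x : Fin s × Fin n → ℤ)
    (hx : ∀ g : GroebnerComplexity.universalGroebnerBasis K A,
      Nat.card {j : Fin s // GroebnerComplexity.layer x j = (g : Fin n → ℤ)} = lam g) :
    GroebnerComplexity.lawrenceLifting A s *ᵥ x = 0 ∧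
      x ∈ GroebnerComplexity.universalGroebnerBasis K
        (GroebnerComplexity.lawrenceLifting A s) := by
  classical
  open GroebnerComplexity in
  have hcount : ∀ g : universalGroebnerBasis K A,
      (Finset.univ.filter fun j => layer x j = (g : Fin n → ℤ)).card = lam g := fun g => by
    rw [← hx g, Nat.card_eq_fintype_card, Fintype.card_subtype]
  have hU : ∀ j, layer x j ∈ universalGroebnerBasis K A := by
    -- The sets of layers equal to the various `g` are disjoint and have total size `s`, so no layer
    -- lies outside `U(A)`.
    have hcard : (lam.support.biUnion fun g =>
        Finset.univ.filter fun j => layer x j = (g : Fin n → ℤ)).card = Fintype.card (Fin s) := by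
      rw [Finset.card_biUnion, Fintype.card_fin]
      · exact (Finset.sum_congr rfl fun g _ => hcount g).trans hs.symm
      · intro g _ h _ hgh
        refine Finset.disjoint_left.2 fun j hj hj' => hgh (Subtype.ext ?_)
        exact (Finset.mem_filter.1 hj).2.symm.trans (Finset.mem_filter.1 hj').2
    intro j
    have hj := Finset.mem_univ j
    rw [← Finset.card_eq_iff_eq_univ _ |>.1 hcard, Finset.mem_biUnion] at hj
    obtain ⟨g, -, hg⟩ := hj
    exact (Finset.mem_filter.1 hg).2 ▸ g.2
  let g : Fin s → universalGroebnerBasis K A := fun j => ⟨layer x j, hU j⟩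
  have hg : ∑ j, Finsupp.single (g j) 1 = lam := by
    ext h
    rw [← hcount h, Finsupp.finsetSum_apply, Finset.card_filter]
    refine Finset.sum_congr rfl fun j _ => ?_
    simp [Finsupp.single_apply, g, Subtype.ext_iff]
  have hsum : ∑ j, layer x j = 0 := by
    have h := hlam.1.2
    rwa [← hg, sum_sum_single] at h
  have hker : lawrenceLifting A s *ᵥ x = 0 := by
    rw [← Matrix.mulVec_zero (lawrenceLifting A s), lawrenceLifting_mulVec_eq_iff]
    refine ⟨hsum.trans ?_, fun j => (mem_universalGroebnerBasis_iff.1 (hU j)).1.trans ?_⟩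
    · exact (Finset.sum_eq_zero fun j _ => rfl).symm
    · exact (Matrix.mulVec_zero A).symm
  refine ⟨hker, mem_universalGroebnerBasis_lawrenceLifting ?_ hker hU (fun j => hsymm _ (hU j))
    fun T hT => hlam.eq_empty_or_eq_univ hg hT⟩
  -- The zero vector is not in `U(A)`, since its positive and negative parts coincide; so `x = 0`
  -- would leave no layers and make `lam` zero.
  rintro rfl
  refine hlam.1.1 ?_
  rw [← hg]
  refine Finset.sum_eq_zero fun j _ => ?_
  obtain ⟨-, m, hlt, -⟩ := mem_universalGroebnerBasis_iff.1 (hU j)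
  exact absurd rfl hlt.ne
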